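/- **Setting.** A *ground BFASP* consists of standard variables $s$, each with a nonempty domain, founded variables $y$, each ranging over a complete chain of values (such as $\{\mathit{false}<\mathit{true}\}$, $\mathbb Z\cup\{\pm\infty\}$, $\mathbb R\cup\{\pm\infty\}$), constraints $c$ (sets of assignments over $\mathrm{vars}(c)$), and rules $(c,y)$ with a founded head $y\in\mathrm{vars}(c)$. The *reduct* $r^\theta$ of a rule $r=(c,y)$ replaces in $c$ every variable $x\ne y$ that is standard, or in which $c$ is not decreasing, by $\theta(x)$. An assignment $\theta$ with values in the domains is a *stable solution* if it satisfies all constraints and is the minimal solution of the reduct of all rules w.r.t. $\theta$. A *non-ground BFASP* $P$ has finitely many arrays of founded or standard variables, non-ground constraints, possibly a set of objective/output variables, and rules $\forall i\in gen(r):\ y[l_0(i)]\ge f(x_1[l_1(i)],\dots,x_n[l_n(i)])$; $\mathrm{ground}(P)$ is its full instantiation. The dependency graph on founded arrays has, for each rule, an edge from the head array to each founded body array, marked increasing, decreasing or non-monotonic according to $f$ in that argument (over the domains). $P$ is *valid* if no edge inside a strongly connected component is non-monotonic; a component is *unstratified* if it has a decreasing edge between two of its nodes. Let $ujb$ assign to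 each founded variable an *unconditionally justified bound*: for every assignment $\theta$, every solution $\eta$ of the reduct of $\mathrm{ground}(P)$ w.r.t. $\theta$ has $\eta(y)\ge ujb(y)$. For each rule $r$ let $\varphi_r$ be a grounding condition of one of the forms true, false, $\bigwedge_k created(x_{j_k}[l_{j_k}])$, $\bigvee_k created(x_{j_k}[l_{j_k}])$ (over founded body literals) that is *necessary* for the head to be justified above its $ujb$: for every instance of $r$ with head $y$, every $\theta$, and all values $\eta$ of the remaining variables, if $r^\theta$ demands at $\eta$ a value greater than $ujb(y)$ for $y$, then $\varphi_r$ holds when $created(x)$ is read as $\eta(x)>ujb(x)$. *Bottom-up grounding with magic sets* derives facts $m\_x$ and $created(x)$ as follows. (Query) $m\_x$ is derived for each $x$ occurring in a ground constraint or in the objective, and for each variable of each array in an unstratified component. For each instance of a rule $r$ with head $a$ and literals $x_1,\dots,x_n$: if $\varphi_r$ is a disjunction, $m\_a$ yields $m\_x_j$ for each $x_j$ in $\varphi_r$; if $\varphi_r=\bigwedge_{k}created(x_{j_k})$, then $m\_a\wedge created(x_{j_1})\wedge\dots\wedge created(x_{j_{k-1}})$ yields $m\_x_{j_k}$; $m\_a\wedge\varphi_r$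 yields $m\_x_j$ for each $x_j$ not in $\varphi_r$, and it yields $created(a)$ and generates the rule instance. The ground BFASP $M$ consists of all ground constraints of $P$, the generated rule instances, and the rule $(y\ge ujb(y),y)$ for each founded variable $y$ of $M$, where $\mathrm{vars}(M)$ is the set of variables occurring in the constraints, the objective or the generated rule instances. **Theorem.** Let $P$ be a valid non-ground BFASP, with $ujb$, $(\varphi_r)_r$ and $M$ as above, and let $G=\mathrm{ground}(P)$. If $\theta'$ is a stable solution of $G$, then $\theta'|_{\mathrm{vars}(M)}$ is a stable solution of $M$. If $\theta$ is a stable solution of $M$, then there is a stable solution $\theta'$ of $G$ with $\theta'|_{\mathrm{vars}(M)}=\theta$. -/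

import Mathlib

universe u v w t

namespace BFASP

/-! ### Ground programs -/

section Ground

variable {V : Type u} {Val : V → Type v}

/-- An assignment over the set of variables `W`; `Val x` is the type of values of `x`. -/
abbrev Assignment (Val : V → Type v) (W : Set V) : Type (max u v) := (x : W) → Val x

/-- The restriction of an assignment to a smaller set of variables. -/
def Assignment.restrict {W W' : Set V} (θ : Assignment Val W') (h : W ⊆ W') : Assignment Val W :=
  fun x => θ ⟨x.1, h x.2⟩

/-- The assignment takes its values in the domains `D`. -/
def Assignment.InDom {W : Set V} (D : (x : V) → Set (Val x)) (θ : Assignment Val W) : Prop :=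
  ∀ x : W, θ x ∈ D x

/-- A constraint is a set of assignments over its variables. -/
structure Constraint (Val : V → Type v) where
  vars : Set V
  sols : Set (Assignment Val vars)

/-- A constraint is (monotonically) decreasing in `x` if decreasing the value of `x` in a solution
gives a solution again; only values in the domains count. -/
def Constraint.DecreasingIn [∀ x, Preorder (Val x)] (D : (x : V) → Set (Val x))
    (c : Constraint Val) (x : V) : Prop :=
  ∃ hx : x ∈ c.vars, ∀ θ θ' : Assignment Val c.vars, θ.InDom D → θ'.InDom D →
    θ ∈ c.sols → θ' ⟨x, hx⟩ < θ ⟨x, hx⟩ → (∀ y : c.vars, y.1 ≠ x → θ' y = θ y) → θ' ∈ c.sols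

/-- A rule is a constraint together with one of its variables, the head. -/
structure Rule (Val : V → Type v) where
  constraint : Constraint Val
  head : V
  head_mem : head ∈ constraint.vars

/-- A ground bound founded answer set program: standard variables, founded variables, constraints
and rules, together with the domains of the variables. -/
structure Program (Val : V → Type v) where
  std : Set V
  fnd : Set V
  disjoint : Disjoint std fnd
  dom : (x : V) → Set (Val x)
  constraints : Set (Constraint Val)
  rules : Set (Rule Val)
  constraint_vars : ∀ c ∈ constraints, c.vars ⊆ std ∪ fnd
  rule_vars : ∀ r ∈ rules, r.constraint.vars ⊆ std ∪ fnd
  rule_head : ∀ r ∈ rules, r.head ∈ fnd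

namespace Program

variable [∀ x, Preorder (Val x)] (P : Program Val)

/-- The variables of a program. -/
def vars : Set V := P.std ∪ P.fnd

/-- `x` stays a variable in the reduct of the rule `r`: it is the head, or it is a founded variable
in which the constraint of `r` is decreasing.  The other variables are replaced by their values. -/
def Kept (r : Rule Val) (x : V) : Prop :=
  x = r.head ∨ (x ∈ P.fnd ∧ r.constraint.DecreasingIn P.dom x)

open Classical in
/-- The values at which the reduct of `r` with respect to `θ` reads the constraint of `r` when its
remaining variables have the values given by `η`. -/
noncomputable def mix (r : Rule Val) (h : r.constraint.vars ⊆ P.vars)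
    (θ η : Assignment Val P.vars) : Assignment Val r.constraint.vars :=
  fun x => if P.Kept r x.1 then η ⟨x.1, h x.2⟩ else θ ⟨x.1, h x.2⟩

/-- `η` satisfies the reduct of the program with respect to `θ`.  The reduct does not mention
standard variables, so only the values of `η` at founded variables matter. -/
def SatisfiesReduct (θ η : Assignment Val P.vars) : Prop :=
  ∀ (r : Rule Val) (hr : r ∈ P.rules), P.mix r (P.rule_vars r hr) θ η ∈ r.constraint.sols

/-- `θ` is a stable solution: it satisfies all constraints and is the minimal solution of the
reduct with respect to itself. -/
def Stable (θ : Assignment Val P.vars) : Prop :=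
  θ.InDom P.dom ∧
  (∀ (c : Constraint Val) (hc : c ∈ P.constraints),
    θ.restrict (P.constraint_vars c hc) ∈ c.sols) ∧
  P.SatisfiesReduct θ θ ∧
  ¬ ∃ η : Assignment Val P.vars, η.InDom P.dom ∧ P.SatisfiesReduct θ η ∧
    ∃ x : P.vars, x.1 ∈ P.fnd ∧ η x < θ x

end Program

end Ground

/-! ### Non-ground programs -/

section NonGround

variable {Arr : Type u}

/-- The ground variables: an array together with a tuple of array indices. -/
abbrev GVar (Idx : Arr → Type v) : Type (max u v) := (a : Arr) × Idx a

/-- The type of values of a ground variable depends only on its array. -/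
abbrev GVal (Idx : Arr → Type v) (Val : Arr → Type w) (x : GVar Idx) : Type w := Val x.1

/-- A non-ground rule `∀ i, gen(i) : y[l₀(i)] ≥ f(x₁[l₁(i)], …, xₙ[lₙ(i)])`. `Ix` is the type of
tuples of index values, and `gen` the set of those satisfying the generator constraint. -/
structure NRule (Idx : Arr → Type v) (Val : Arr → Type w) where
  Ix : Type t
  gen : Set Ix
  headArr : Arr
  headLit : gen → Idx headArr
  arity : ℕ
  arr : Fin arity → Arr
  lit : (j : Fin arity) → gen → Idx (arr j)
  fn : ((j : Fin arity) → Val (arr j)) → Val headArr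

/-- A non-ground constraint `∀ i, gen(i) : R(x₁[l₁(i)], …, xₙ[lₙ(i)])`. -/
structure NConstraint (Idx : Arr → Type v) (Val : Arr → Type w) where
  Ix : Type t
  gen : Set Ix
  arity : ℕ
  arr : Fin arity → Arr
  lit : (j : Fin arity) → gen → Idx (arr j)
  rel : Set ((j : Fin arity) → Val (arr j))

variable {Idx : Arr → Type v} {Val : Arr → Type w}

namespace NRule

variable (r : NRule.{u, v, w, t} Idx Val) (i : r.gen)

/-- The head of the instance of `r` at `i`. -/
abbrev headVar : GVar Idx := ⟨r.headArr, r.headLit i⟩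

/-- The `j`-th body variable of the instance of `r` at `i`. -/
abbrev argVar (j : Fin r.arity) : GVar Idx := ⟨r.arr j, r.lit j i⟩

/-- The variables of the instance of `r` at `i`. -/
def instVars : Set (GVar Idx) := insert (r.headVar i) (Set.range (r.argVar i))

theorem head_mem : r.headVar i ∈ r.instVars i := Set.mem_insert _ _

theorem arg_mem (j : Fin r.arity) : r.argVar i j ∈ r.instVars i :=
  Set.mem_insert_of_mem _ ⟨j, rfl⟩

/-- The value of the body function of the instance of `r` at `i`. -/
def bodyValue (θ : Assignment (GVal Idx Val) (r.instVars i)) : Val r.headArr :=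
  r.fn fun j => θ ⟨r.argVar i j, r.arg_mem i j⟩

/-- The ground rule obtained from `r` at the index tuple `i`. -/
def inst [∀ a, Preorder (Val a)] : Rule (GVal Idx Val) where
  constraint :=
    { vars := r.instVars i
      sols := {θ | r.bodyValue i θ ≤ θ ⟨r.headVar i, r.head_mem i⟩} }
  head := r.headVar i
  head_mem := r.head_mem i

end NRule

namespace NConstraint

variable (c : NConstraint.{u, v, w, t} Idx Val) (i : c.gen)

/-- The `j`-th variable of the instance of `c` at `i`. -/
abbrev argVar (j : Fin c.arity) : GVar Idx := ⟨c.arr j, c.lit j i⟩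

/-- The ground constraint obtained from `c` at the index tuple `i`. -/
def inst : Constraint (GVal Idx Val) where
  vars := Set.range (c.argVar i)
  sols := {θ | (fun j => θ ⟨c.argVar i j, ⟨j, rfl⟩⟩) ∈ c.rel}

end NConstraint

/-- The rule `(x ≥ b, x)`. -/
def boundRule [∀ a, Preorder (Val a)] (x : GVar Idx) (b : Val x.1) : Rule (GVal Idx Val) where
  constraint :=
    { vars := {x}
      sols := {θ | b ≤ θ ⟨x, rfl⟩} }
  head := x
  head_mem := rfl

/-- A non-ground program.  The arrays in `founded` hold founded variables, the others standard
variables (or parameters: standard variables whose domain is a single value).  `dom` gives the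
domains of the standard variables; a founded variable ranges over its whole type of values.
`objective` is the set of ground variables in the objective function and of output variables. -/
structure NProgram (Idx : Arr → Type v) (Val : Arr → Type w) where
  founded : Set Arr
  dom : (x : GVar Idx) → Set (Val x.1)
  dom_nonempty : ∀ x, (dom x).Nonempty
  rules : Set (NRule.{u, v, w, t} Idx Val)
  constraints : Set (NConstraint.{u, v, w, t} Idx Val)
  objective : Set (GVar Idx)
  head_founded : ∀ r ∈ rules, r.headArr ∈ founded

/-- The four forms that the grounding condition of a rule with `n` body literals can have; the
numbers in the lists stand for body literals, `j` in a list for the atom `created(xⱼ[lⱼ])`. -/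
inductive Cond (n : ℕ) : Type
  | tru : Cond n
  | fls : Cond n
  | conj : List (Fin n) → Cond n
  | disj : List (Fin n) → Cond n

namespace Cond

variable {n : ℕ}

/-- The body literals whose `created` atoms occur in the condition. -/
def atoms : Cond n → List (Fin n)
  | tru => []
  | fls => []
  | conj l => l
  | disj l => l

/-- The condition is true when `p j` is the truth value of the atom of the `j`-th body literal. -/
def Sat (p : Fin n → Prop) : Cond n → Prop
  | tru => True
  | fls => False
  | conj l => ∀ j ∈ l, p j
  | disj l => ∃ j ∈ l, p j

end Cond

namespace NProgram

variable (P : NProgram.{u, v, w, t} Idx Val)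

/-- The domains of all ground variables. -/
def gdom (x : GVar Idx) : Set (Val x.1) := {b | x.1 ∉ P.founded → b ∈ P.dom x}

/-- The exhaustive grounding of a program. -/
def ground [∀ a, Preorder (Val a)] : Program (GVal Idx Val) where
  std := {x | x.1 ∉ P.founded}
  fnd := {x | x.1 ∈ P.founded}
  disjoint := Set.disjoint_left.2 fun _ h h' => h h'
  dom := P.gdom
  constraints := {c | ∃ c₀ ∈ P.constraints, ∃ i : c₀.gen, c = c₀.inst i}
  rules := {r | ∃ r₀ ∈ P.rules, ∃ i : r₀.gen, r = r₀.inst i}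
  constraint_vars := fun _ _ x _ => (em (x.1 ∈ P.founded)).symm
  rule_vars := fun _ _ x _ => (em (x.1 ∈ P.founded)).symm
  rule_head := by
    rintro r ⟨r₀, hr₀, i, rfl⟩
    exact P.head_founded r₀ hr₀

theorem mem_ground_vars [∀ a, Preorder (Val a)] (x : GVar Idx) : x ∈ P.ground.vars :=
  (em (x.1 ∈ P.founded)).symm

/-! #### The predicate dependency graph -/

/-- The body function of `r` is increasing in its `j`-th argument, over the domains of the
variables of its instances. -/
def IncreasingArg [∀ a, Preorder (Val a)] (r : NRule.{u, v, w, t} Idx Val) (j : Fin r.arity) :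
    Prop :=
  ∀ (i : r.gen) (a b : (k : Fin r.arity) → Val (r.arr k)),
    (∀ k, a k ∈ P.gdom (r.argVar i k)) → (∀ k, b k ∈ P.gdom (r.argVar i k)) →
    (∀ k, k ≠ j → a k = b k) → a j ≤ b j → r.fn a ≤ r.fn b

/-- The body function of `r` is decreasing in its `j`-th argument, over the domains of the
variables of its instances. -/
def DecreasingArg [∀ a, Preorder (Val a)] (r : NRule.{u, v, w, t} Idx Val) (j : Fin r.arity) :
    Prop :=
  ∀ (i : r.gen) (a b : (k : Fin r.arity) → Val (r.arr k)),
    (∀ k, a k ∈ P.gdom (r.argVar i k)) → (∀ k, b k ∈ P.gdom (r.argVar i k)) →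
    (∀ k, k ≠ j → a k = b k) → a j ≤ b j → r.fn b ≤ r.fn a

/-- The predicate dependency graph: an edge from the head array of each rule to each founded array
in its body. -/
def Edge (a b : Arr) : Prop :=
  ∃ r ∈ P.rules, r.headArr = a ∧ ∃ j, r.arr j = b ∧ b ∈ P.founded

/-- Two arrays lie in the same strongly connected component of the dependency graph. -/
def SameComponent (a b : Arr) : Prop :=
  Relation.ReflTransGen P.Edge a b ∧ Relation.ReflTransGen P.Edge b a

/-- The program is valid: no edge within a component is non-monotonic. -/
def Valid [∀ a, Preorder (Val a)] : Prop :=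
  ∀ r ∈ P.rules, ∀ j, r.arr j ∈ P.founded → P.SameComponent r.headArr (r.arr j) →
    P.IncreasingArg r j ∨ P.DecreasingArg r j

/-- The array `a` is part of a component that has a decreasing edge (one that is not also
increasing) between two of its nodes. -/
def Unstratified [∀ a, Preorder (Val a)] (a : Arr) : Prop :=
  a ∈ P.founded ∧ ∃ r ∈ P.rules, ∃ j, r.arr j ∈ P.founded ∧
    P.SameComponent r.headArr (r.arr j) ∧ P.DecreasingArg r j ∧ ¬ P.IncreasingArg r j ∧
    P.SameComponent a r.headArr

/-! #### Unconditionally justified bounds and grounding conditions -/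

/-- The bounds `ujb` are unconditionally justified by the rules: whatever assignment the reduct is
taken with, all its solutions respect them. -/
def UnconditionallyJustified [∀ a, Preorder (Val a)] (ujb : (x : GVar Idx) → Val x.1) : Prop :=
  ∀ θ η : Assignment (GVal Idx Val) P.ground.vars, θ.InDom P.gdom → η.InDom P.gdom →
    P.ground.SatisfiesReduct θ η →
    ∀ x : P.ground.vars, x.1.1 ∈ P.founded → ujb x.1 ≤ η x

/-- `φ` is a necessary condition for the rule `r` to justify its head above its `ujb` value: its
atoms are about founded variables and, for every instance of `r`, if the reduct of the instance
with respect to some assignment `θ` demands, at the values `η` of the remaining variables, more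
than the `ujb` value of the head, then `φ` holds, where `created(x)` means that the value of `x`
(under `η`) is above `ujb(x)`. -/
def Necessary [∀ a, Preorder (Val a)] (ujb : (x : GVar Idx) → Val x.1)
    (r : NRule.{u, v, w, t} Idx Val) (φ : Cond r.arity) : Prop :=
  (∀ j ∈ φ.atoms, r.arr j ∈ P.founded) ∧
  ∀ (i : r.gen) (θ η : Assignment (GVal Idx Val) P.ground.vars),
    θ.InDom P.gdom → η.InDom P.gdom →
    ujb (r.headVar i) <
      r.bodyValue i (P.ground.mix (r.inst i) (fun x _ => P.mem_ground_vars x) θ η) →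
    φ.Sat fun j => ujb (r.argVar i j) < η ⟨r.argVar i j, P.mem_ground_vars _⟩

/-! #### Bottom-up grounding with magic sets -/

/-- The initial query: the variables of the ground constraints and of the objective, and all
variables of the arrays in unstratified components. -/
def query [∀ a, Preorder (Val a)] : Set (GVar Idx) :=
  {x | (∃ c ∈ P.constraints, ∃ (i : c.gen) (j : Fin c.arity), x = c.argVar i j) ∨
    x ∈ P.objective ∨ P.Unstratified x.1}

variable (φ : (r : NRule.{u, v, w, t} Idx Val) → Cond r.arity)

mutual

/-- The magic variable of `x` is derived when the program with magic rules is grounded bottom-up. -/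
inductive Magic [∀ a, Preorder (Val a)] : GVar Idx → Prop
  | query (x : GVar Idx) : x ∈ P.query → Magic x
  | disj (r : NRule.{u, v, w, t} Idx Val) (i : r.gen) (l : List (Fin r.arity)) (j : Fin r.arity) :
      r ∈ P.rules → φ r = Cond.disj l → j ∈ l →
      Magic (r.headVar i) → Magic (r.argVar i j)
  | conj (r : NRule.{u, v, w, t} Idx Val) (i : r.gen) (l l' : List (Fin r.arity))
      (j : Fin r.arity) :
      r ∈ P.rules → φ r = Cond.conj (l ++ j :: l') →
      Magic (r.headVar i) → (∀ k ∈ l, Created (r.argVar i k)) → Magic (r.argVar i j)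
  | rest (r : NRule.{u, v, w, t} Idx Val) (i : r.gen) (S : Set (Fin r.arity)) (j : Fin r.arity) :
      r ∈ P.rules → j ∉ (φ r).atoms → (φ r).Sat (fun k => k ∈ S) →
      Magic (r.headVar i) → (∀ k ∈ S, Created (r.argVar i k)) → Magic (r.argVar i j)

/-- The founded variable `x` is created when the program with magic rules is grounded bottom-up:
the magic variable of `x` has been derived, and the grounding condition of a rule instance with
head `x` holds because of a set `S` of created body variables. -/
inductive Created [∀ a, Preorder (Val a)] : GVar Idx → Prop
  | rule (r : NRule.{u, v, w, t} Idx Val) (i : r.gen) (S : Set (Fin r.arity)) :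
      r ∈ P.rules → (φ r).Sat (fun k => k ∈ S) →
      Magic (r.headVar i) → (∀ k ∈ S, Created (r.argVar i k)) → Created (r.headVar i)

end

/-- The instance of the rule `r` at `i` is generated by bottom-up grounding with magic sets. -/
def Generated [∀ a, Preorder (Val a)] (r : NRule.{u, v, w, t} Idx Val) (i : r.gen) : Prop :=
  r ∈ P.rules ∧ P.Magic φ (r.headVar i) ∧ (φ r).Sat fun j => P.Created φ (r.argVar i j)

/-- The variables that occur in the constraints, in the objective, or in the generated rules. -/
def magicVars [∀ a, Preorder (Val a)] : Set (GVar Idx) :=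
  {x | (∃ c ∈ P.constraints, ∃ (i : c.gen) (j : Fin c.arity), x = c.argVar i j) ∨
    x ∈ P.objective ∨
    ∃ (r : NRule.{u, v, w, t} Idx Val) (i : r.gen), P.Generated φ r i ∧ x ∈ r.instVars i}

/-- The ground program produced by bottom-up grounding with magic sets: all ground constraints, the
generated rules, and the rule `(x ≥ ujb(x), x)` for each of its founded variables `x`. -/
def magicGround [∀ a, Preorder (Val a)] (ujb : (x : GVar Idx) → Val x.1) :
    Program (GVal Idx Val) where
  std := {x | x ∈ P.magicVars φ ∧ x.1 ∉ P.founded}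
  fnd := {x | x ∈ P.magicVars φ ∧ x.1 ∈ P.founded}
  disjoint := Set.disjoint_left.2 fun _ h h' => h.2 h'.2
  dom := P.gdom
  constraints := {c | ∃ c₀ ∈ P.constraints, ∃ i : c₀.gen, c = c₀.inst i}
  rules := {r | (∃ (r₀ : NRule.{u, v, w, t} Idx Val) (i : r₀.gen),
      P.Generated φ r₀ i ∧ r = r₀.inst i) ∨
    ∃ x ∈ P.magicVars φ, x.1 ∈ P.founded ∧ r = boundRule x (ujb x)}
  constraint_vars := by
    rintro _ ⟨c, hc, i, rfl⟩ x ⟨j, rfl⟩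
    have h : c.argVar i j ∈ P.magicVars φ := Or.inl ⟨c, hc, i, j, rfl⟩
    exact (em ((c.argVar i j).1 ∈ P.founded)).symm.imp (fun h' => ⟨h, h'⟩) fun h' => ⟨h, h'⟩
  rule_vars := by
    rintro _ (⟨r, i, hr, rfl⟩ | ⟨y, hy, hf, rfl⟩) x hx
    · have h : x ∈ P.magicVars φ := Or.inr (Or.inr ⟨r, i, hr, hx⟩)
      exact (em (x.1 ∈ P.founded)).symm.imp (fun h' => ⟨h, h'⟩) fun h' => ⟨h, h'⟩
    · obtain rfl : x = y := hx
      exact Or.inr ⟨hy, hf⟩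
  rule_head := by
    rintro _ (⟨r, i, hr, rfl⟩ | ⟨y, hy, hf, rfl⟩)
    · exact ⟨Or.inr (Or.inr ⟨r, i, hr, r.head_mem i⟩), P.head_founded r hr.1⟩
    · exact ⟨hy, hf⟩

theorem magicGround_vars_subset [∀ a, Preorder (Val a)] (ujb : (x : GVar Idx) → Val x.1) :
    (P.magicGround φ ujb).vars ⊆ P.ground.vars :=
  fun x _ => P.mem_ground_vars x

end NProgram

end NonGround

end BFASP

-- A rule instance left out of M cannot lift a magic head above its `ujb`, as long as uncreated
-- magic variables do not exceed theirs. Its condition is necessary, so lifting the head would make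
-- the condition true, and the magic rules would then have found its atoms created
-- (`generated_of_sat`, `eval_mixVal_le_ujb`). The proviso follows from minimality: in a stable
-- solution of either program, resetting such variables to `ujb` still solves the reduct. In
-- addition, solutions of a reduct are closed under pointwise minimum (`SatInst.min`), so a
-- competitor of a candidate may be assumed to lie below it.
--
-- From G to M, a competitor in M is cut down by the stable solution and extended by it outside
-- vars(M); the result is a competitor in G.
--
-- From M to G, values are needed outside vars(M). Magic founded variables get `ujb`. Unmagic
-- founded variables lie in components with no purely decreasing edge, because unstratified
-- components are queried. By validity the rules are therefore monotone within each such component,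
-- and least fixed points exist. They are taken in order of `rank`, the number of reachable arrays,
-- which never grows along an edge and stays constant only inside a component. A competitor in G is
-- bounded below on vars(M) by stability in M, on other magic variables by `ujb`, and on unmagic
-- ones by induction on rank (`le_of_levelLeast`).

namespace BFASP

-- Total valuations and decreasing constraints

section MagicSets

variable {Arr : Type u} {Idx : Arr → Type v} {Val : Arr → Type w}

/-- The restriction of a total valuation to a set of variables. -/
abbrev onVars (W : Set (GVar Idx)) (σ : (x : GVar Idx) → Val x.1) :
    Assignment (GVal Idx Val) W := fun x => σ x.1

open Classical in
-- Total valuations let both programs be compared on the same functions, without transporting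
-- between subtypes.
theorem exists_extension (W : Set (GVar Idx)) (θ : Assignment (GVal Idx Val) W)
    (σ₀ : (x : GVar Idx) → Val x.1) :
    ∃ σ : (x : GVar Idx) → Val x.1, onVars W σ = θ ∧ ∀ x ∉ W, σ x = σ₀ x := by
  refine ⟨fun x => if h : x ∈ W then θ ⟨x, h⟩ else σ₀ x, ?_, fun x hx => dif_neg hx⟩
  funext x
  exact dif_pos x.2

theorem Cond.Sat.mono {n : ℕ} {p q : Fin n → Prop} {c : Cond n} (h : c.Sat p)
    (hpq : ∀ j ∈ c.atoms, p j → q j) : c.Sat q := by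
  cases c with
  | tru => trivial
  | fls => exact h
  | conj l => exact fun j hj => hpq j hj (h j hj)
  | disj l =>
    obtain ⟨j, hj, hp⟩ := h
    exact ⟨j, hj, hpq j hj hp⟩

/-- A solution of a constraint on finitely many variables stays a solution when the values of
variables in which the constraint is decreasing are lowered. -/
theorem Constraint.mem_sols_of_le {V : Type u} {Val : V → Type v} [∀ x, PartialOrder (Val x)]
    {D : (x : V) → Set (Val x)} {c : Constraint Val} [Finite c.vars]
    {σ τ : Assignment Val c.vars} (hσ : σ.InDom D) (hτ : τ.InDom D) (h : σ ∈ c.sols)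
    (hle : ∀ x : c.vars, τ x = σ x ∨ (τ x ≤ σ x ∧ c.DecreasingIn D x)) : τ ∈ c.sols := by
  classical
  have := Fintype.ofFinite c.vars
  -- `DecreasingIn` changes one variable at a time, so `σ` is turned into `τ` one coordinate at a
  -- time; this is where finiteness of `c.vars` matters.
  let hyb : Finset c.vars → Assignment Val c.vars := fun s x => if x ∈ s then τ x else σ x
  have hyb_dom : ∀ s, (hyb s).InDom D := by
    intro s x
    by_cases hx : x ∈ s
    · simpa [hyb, hx] using hτ x
    · simpa [hyb, hx] using hσ x
  have key : ∀ s : Finset c.vars, hyb s ∈ c.sols := by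
    intro s
    induction s using Finset.induction_on with
    | empty => simpa [hyb] using h
    | insert a s ha ih =>
      have hne : ∀ y : c.vars, y.1 ≠ a.1 → hyb (insert a s) y = hyb s y := by
        intro y hy
        have : y ≠ a := fun e => hy (congrArg _ e)
        simp [hyb, this]
      have h1 : hyb (insert a s) a = τ a := by simp [hyb]
      have h2 : hyb s a = σ a := by simp [hyb, ha]
      have heq : τ a = σ a → hyb (insert a s) = hyb s := by
        intro e
        funext y
        by_cases hy : y = a
        · subst hy
          rw [h1, h2, e]
        · exact hne y fun e' => hy (Subtype.ext e')
      rcases hle a with e | ⟨hl, hd⟩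
      · rwa [heq e]
      · rcases hl.lt_or_eq with hlt | e
        · obtain ⟨hx, hd⟩ := hd
          exact hd (hyb s) (hyb (insert a s)) (hyb_dom _) (hyb_dom _) ih
            (by rw [h1, h2]; exact hlt) hne
        · rwa [heq e]
  have hu := key Finset.univ
  simpa [hyb] using hu

namespace NRule

/-- The body value of the instance of `r` at `i` under a total valuation. -/
def eval (r : NRule.{u, v, w, t} Idx Val) (i : r.gen) (σ : (x : GVar Idx) → Val x.1) :
    Val r.headArr :=
  r.fn fun j => σ (r.argVar i j)

instance (r : NRule.{u, v, w, t} Idx Val) (i : r.gen) : Finite (r.instVars i) := by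
  unfold instVars
  infer_instance

end NRule

namespace NProgram

variable (P : NProgram.{u, v, w, t} Idx Val)

/-- A total valuation with values in the domains. -/
def InDom (σ : (x : GVar Idx) → Val x.1) : Prop := ∀ x, σ x ∈ P.gdom x

variable {P} in
theorem InDom.ite {σ τ : (x : GVar Idx) → Val x.1} (hσ : P.InDom σ) (hτ : P.InDom τ)
    (p : GVar Idx → Prop) [DecidablePred p] : P.InDom fun x => if p x then σ x else τ x := by
  intro x
  by_cases h : p x
  · simpa [h] using hσ x
  · simpa [h] using hτ x

variable {P} in
theorem InDom.of_standard {σ τ : (x : GVar Idx) → Val x.1} (hσ : P.InDom σ)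
    (h : ∀ x, x.1 ∉ P.founded → τ x = σ x) : P.InDom τ :=
  fun x hx => by
    rw [h x hx]
    exact hσ x hx

/-! ### Levels of the dependency graph -/

/-- The number of arrays on which the array `a` depends. -/
noncomputable def rank (a : Arr) : ℕ := {b | Relation.ReflTransGen P.Edge a b}.ncard

variable {P}

theorem rank_le_card [Finite Arr] (a : Arr) : P.rank a ≤ Nat.card Arr :=
  Set.ncard_le_card _

theorem edge_of_mem_rules {r : NRule.{u, v, w, t} Idx Val} (hr : r ∈ P.rules) {j : Fin r.arity}
    (hj : r.arr j ∈ P.founded) :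
    P.Edge r.headArr (r.arr j) :=
  ⟨r, hr, rfl, j, rfl, hj⟩

theorem Edge.reach_subset {a b : Arr} (h : P.Edge a b) :
    {c | Relation.ReflTransGen P.Edge b c} ⊆ {c | Relation.ReflTransGen P.Edge a c} :=
  fun _ hc => Relation.ReflTransGen.head h hc

theorem Edge.rank_le [Finite Arr] {a b : Arr} (h : P.Edge a b) : P.rank b ≤ P.rank a :=
  Set.ncard_le_ncard h.reach_subset

/-- Along an edge the reachable sets are nested. Equal finite cardinality makes them equal, so `a`
is reachable from `b`. -/
theorem Edge.sameComponent [Finite Arr] {a b : Arr} (h : P.Edge a b) (hr : P.rank a ≤ P.rank b) :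
    P.SameComponent a b := by
  have e := Set.eq_of_subset_of_ncard_le h.reach_subset hr
  have ha : a ∈ {c | Relation.ReflTransGen P.Edge b c} := e ▸ Relation.ReflTransGen.refl
  exact ⟨Relation.ReflTransGen.single h, ha⟩

/-! ### Reducts of rule instances -/

variable [∀ a, CompleteLinearOrder (Val a)]

open Classical in
variable (P) in
/-- The total valuation at which the reduct with respect to `θ` of the instance of `r` at `i` is
read when the remaining variables have the values given by `η`. -/
noncomputable def mixVal (r : NRule.{u, v, w, t} Idx Val) (i : r.gen)
    (θ η : (x : GVar Idx) → Val x.1) : (x : GVar Idx) → Val x.1 :=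
  fun x => if P.ground.Kept (r.inst i) x then η x else θ x

variable (P) in
/-- `η` satisfies the reduct with respect to `θ` of the instance of `r` at `i`. -/
def SatInst (θ η : (x : GVar Idx) → Val x.1) (r : NRule.{u, v, w, t} Idx Val) (i : r.gen) :
    Prop :=
  r.eval i (P.mixVal r i θ η) ≤ η (r.headVar i)

variable {θ η η' σ τ : (x : GVar Idx) → Val x.1} {r : NRule.{u, v, w, t} Idx Val} {i : r.gen}

theorem InDom.mixVal (hθ : P.InDom θ) (hη : P.InDom η) : P.InDom (P.mixVal r i θ η) := by
  classical
  exact hη.ite hθ _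

theorem mixVal_self : P.mixVal r i θ θ = θ := by
  funext x
  simp [NProgram.mixVal]

theorem mixVal_head : P.mixVal r i θ η (r.headVar i) = η (r.headVar i) :=
  if_pos (Or.inl rfl)

theorem satInst_self : P.SatInst θ θ r i ↔ r.eval i θ ≤ θ (r.headVar i) := by
  rw [SatInst, mixVal_self]

/-- Lowering founded variables other than the head preserves the reduct of a rule instance. -/
theorem SatInst.of_le (hθ : P.InDom θ) (hη : P.InDom η) (hη' : P.InDom η')
    (h : P.SatInst θ η r i) (hhead : η' (r.headVar i) = η (r.headVar i))
    (hle : ∀ x, x.1 ∈ P.founded → η' x ≤ η x) : P.SatInst θ η' r i := by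
  have h1 : onVars (r.instVars i) (P.mixVal r i θ η) ∈ (r.inst i).constraint.sols := by
    change r.eval i (P.mixVal r i θ η) ≤ P.mixVal r i θ η (r.headVar i)
    rwa [mixVal_head]
  have : Finite (r.inst i).constraint.vars := inferInstanceAs (Finite (r.instVars i))
  have h2 : onVars (r.instVars i) (P.mixVal r i θ η') ∈ (r.inst i).constraint.sols := by
    refine Constraint.mem_sols_of_le (D := P.gdom) (fun x => hθ.mixVal hη x.1)
      (fun x => hθ.mixVal hη' x.1) h1 fun x => ?_
    by_cases hx : x.1 = r.headVar i
    · left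
      change P.mixVal r i θ η' x.1 = P.mixVal r i θ η x.1
      rw [hx, mixVal_head, mixVal_head, hhead]
    · by_cases hk : P.ground.Kept (r.inst i) x.1
      · right
        obtain h | ⟨hf, hd⟩ := hk
        · exact absurd h hx
        · refine ⟨?_, hd⟩
          change P.mixVal r i θ η' x.1 ≤ P.mixVal r i θ η x.1
          have hk : P.ground.Kept (r.inst i) x.1 := Or.inr ⟨hf, hd⟩
          simpa [NProgram.mixVal, hk] using hle x.1 hf
      · left
        simp [onVars, NProgram.mixVal, hk]
  have h3 : r.eval i (P.mixVal r i θ η') ≤ P.mixVal r i θ η' (r.headVar i) := h2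
  rwa [mixVal_head] at h3

theorem InDom.min (hσ : P.InDom σ) (hτ : P.InDom τ) : P.InDom fun x => min (σ x) (τ x) := by
  intro x
  rcases min_choice (σ x) (τ x) with h | h <;> simp only [h]
  exacts [hσ x, hτ x]

/-- The minimum agrees at the head with whichever valuation is smaller there, and lies below that
valuation elsewhere, so `SatInst.of_le` applies. Linearity of the order supplies the case split. -/
theorem SatInst.min (hθ : P.InDom θ) (hη : P.InDom η) (hη' : P.InDom η')
    (h : P.SatInst θ η r i) (h' : P.SatInst θ η' r i) :
    P.SatInst θ (fun x => min (η x) (η' x)) r i := by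
  rcases le_total (η (r.headVar i)) (η' (r.headVar i)) with hl | hl
  · exact h.of_le hθ hη (hη.min hη') (min_eq_left hl) fun x _ => min_le_left _ _
  · exact h'.of_le hθ hη' (hη.min hη') (min_eq_right hl) fun x _ => min_le_right _ _

/-! ### Reducts and stable solutions in terms of total valuations -/

theorem ground_satisfiesReduct_iff :
    P.ground.SatisfiesReduct (onVars _ θ) (onVars _ η) ↔
      ∀ r ∈ P.rules, ∀ i, P.SatInst θ η r i := by
  have key : ∀ r i (hr : (r.inst i).constraint.vars ⊆ P.ground.vars),
      P.ground.mix (r.inst i) hr (onVars _ θ) (onVars _ η) ∈ (r.inst i).constraint.sols ↔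
        P.SatInst θ η r i := by
    intro r i hr
    change r.eval i (P.mixVal r i θ η) ≤ P.mixVal r i θ η (r.headVar i) ↔ _
    rw [mixVal_head, SatInst]
  constructor
  · intro h r hr i
    exact (key r i _).1 (h _ ⟨r, hr, i, rfl⟩)
  · rintro h _ ⟨r, hr, i, rfl⟩
    exact (key r i _).2 (h r hr i)

/-- As values are linearly ordered, a solution that no other solution undercuts at any variable is a
lower bound of all solutions. -/
theorem ground_stable_iff (hθ : P.InDom θ) :
    P.ground.Stable (onVars _ θ) ↔
      (∀ c ∈ P.constraints, ∀ i, (fun j => θ (c.argVar i j)) ∈ c.rel) ∧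
      (∀ r ∈ P.rules, ∀ i, r.eval i θ ≤ θ (r.headVar i)) ∧
      ∀ η, P.InDom η → (∀ r ∈ P.rules, ∀ i, P.SatInst θ η r i) →
        ∀ x, x.1 ∈ P.founded → θ x ≤ η x := by
  unfold Program.Stable
  rw [ground_satisfiesReduct_iff]
  simp only [satInst_self]
  constructor
  · rintro ⟨-, hc, hr, hm⟩
    refine ⟨fun c hc' i => hc _ ⟨c, hc', i, rfl⟩, hr, fun η hη hs x hx => ?_⟩
    by_contra hlt
    exact hm ⟨onVars _ η, fun x => hη x.1, ground_satisfiesReduct_iff.2 hs,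
      ⟨x, P.mem_ground_vars x⟩, hx, not_le.1 hlt⟩
  · rintro ⟨hc, hr, hm⟩
    refine ⟨fun x => hθ x.1, ?_, hr, ?_⟩
    · rintro _ ⟨c, hc', i, rfl⟩
      exact hc c hc' i
    · rintro ⟨η, hη, hs, x, hx, hlt⟩
      have hη' : P.InDom fun x => η ⟨x, P.mem_ground_vars x⟩ := fun x => hη ⟨x, _⟩
      exact (hm (fun x => η ⟨x, P.mem_ground_vars x⟩) hη'
        (ground_satisfiesReduct_iff.1 hs) x.1 hx).not_gt hlt

variable {φ : (r : NRule.{u, v, w, t} Idx Val) → Cond r.arity} {ujb : (x : GVar Idx) → Val x.1}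

theorem Generated.instVars_subset (h : P.Generated φ r i) : r.instVars i ⊆ P.magicVars φ :=
  fun _ hx => Or.inr (Or.inr ⟨r, i, h, hx⟩)

/-- `Kept` sees the program only through its founded variables and domains, so a generated instance
has the same reduct in both programs. -/
theorem magicGround_kept_iff {r : Rule (GVal Idx Val)} {x : GVar Idx} (hx : x ∈ P.magicVars φ) :
    (P.magicGround φ ujb).Kept r x ↔ P.ground.Kept r x :=
  or_congr_right <| and_congr_left fun _ => and_iff_right hx

theorem magicGround_satisfiesReduct_iff :
    (P.magicGround φ ujb).SatisfiesReduct (onVars _ θ) (onVars _ η) ↔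
      (∀ r i, P.Generated φ r i → P.SatInst θ η r i) ∧
      ∀ x ∈ P.magicVars φ, x.1 ∈ P.founded → ujb x ≤ η x := by
  have key : ∀ r i (_ : P.Generated φ r i)
      (hr : (r.inst i).constraint.vars ⊆ (P.magicGround φ ujb).vars),
      (P.magicGround φ ujb).mix (r.inst i) hr (onVars _ θ) (onVars _ η) ∈
        (r.inst i).constraint.sols ↔ P.SatInst θ η r i := by
    intro r i hg hr
    have : (P.magicGround φ ujb).mix (r.inst i) hr (onVars _ θ) (onVars _ η) =
        onVars (r.instVars i) (P.mixVal r i θ η) := by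
      funext x
      classical
      exact if_congr (magicGround_kept_iff (hg.instVars_subset x.2)) rfl rfl
    rw [this]
    change r.eval i (P.mixVal r i θ η) ≤ P.mixVal r i θ η (r.headVar i) ↔ _
    rw [mixVal_head, SatInst]
  have keyb : ∀ x (hr : (boundRule x (ujb x)).constraint.vars ⊆ (P.magicGround φ ujb).vars),
      (P.magicGround φ ujb).mix (boundRule x (ujb x)) hr (onVars _ θ) (onVars _ η) ∈
        (boundRule x (ujb x)).constraint.sols ↔ ujb x ≤ η x := by
    intro x hr
    have : (P.magicGround φ ujb).mix (boundRule x (ujb x)) hr (onVars _ θ) (onVars _ η) ⟨x, rfl⟩ =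
        η x := if_pos (Or.inl rfl)
    change ujb x ≤ (P.magicGround φ ujb).mix (boundRule x (ujb x)) hr (onVars _ θ) (onVars _ η)
      ⟨x, rfl⟩ ↔ _
    rw [this]
  constructor
  · intro h
    exact ⟨fun r i hg => (key r i hg _).1 (h _ (Or.inl ⟨r, i, hg, rfl⟩)),
      fun x hx hf => (keyb x _).1 (h _ (Or.inr ⟨x, hx, hf, rfl⟩))⟩
  · rintro ⟨h, hb⟩ _ (⟨r, i, hg, rfl⟩ | ⟨x, hx, hf, rfl⟩)
    · exact (key r i hg _).2 (h r i hg)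
    · exact (keyb x _).2 (hb x hx hf)

theorem magicGround_stable_iff (hθ : P.InDom θ) :
    (P.magicGround φ ujb).Stable (onVars _ θ) ↔
      (∀ c ∈ P.constraints, ∀ i, (fun j => θ (c.argVar i j)) ∈ c.rel) ∧
      (∀ r i, P.Generated φ r i → r.eval i θ ≤ θ (r.headVar i)) ∧
      (∀ x ∈ P.magicVars φ, x.1 ∈ P.founded → ujb x ≤ θ x) ∧
      ∀ η, P.InDom η → (∀ r i, P.Generated φ r i → P.SatInst θ η r i) →
        (∀ x ∈ P.magicVars φ, x.1 ∈ P.founded → ujb x ≤ η x) →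
        ∀ x ∈ P.magicVars φ, x.1 ∈ P.founded → θ x ≤ η x := by
  unfold Program.Stable
  rw [magicGround_satisfiesReduct_iff]
  simp only [satInst_self]
  constructor
  · rintro ⟨-, hc, ⟨hr, hb⟩, hm⟩
    refine ⟨fun c hc' i => hc _ ⟨c, hc', i, rfl⟩, hr, hb, fun η hη hs hb' x hx hf => ?_⟩
    by_contra hlt
    exact hm ⟨onVars _ η, fun x => hη x.1, magicGround_satisfiesReduct_iff.2 ⟨hs, hb'⟩,
      ⟨x, Or.inr ⟨hx, hf⟩⟩, ⟨hx, hf⟩, not_le.1 hlt⟩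
  · rintro ⟨hc, hr, hb, hm⟩
    refine ⟨fun x => hθ x.1, ?_, ⟨hr, hb⟩, ?_⟩
    · rintro _ ⟨c, hc', i, rfl⟩
      exact hc c hc' i
    · rintro ⟨η, hη, hs, x, hx, hlt⟩
      -- Values outside vars(M) are irrelevant; taking them from `θ` keeps them in the domains.
      obtain ⟨η, rfl, hout⟩ := exists_extension _ η θ
      have hη' : P.InDom η := by
        intro x
        by_cases hx : x ∈ (P.magicGround φ ujb).vars
        · exact hη ⟨x, hx⟩
        · rw [hout x hx]
          exact hθ x
      obtain ⟨h1, h2⟩ := magicGround_satisfiesReduct_iff.1 hs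
      exact (hm η hη' h1 h2 x.1 hx.1 hx.2).not_gt hlt

/-! ### Magic and created variables -/

theorem Generated.created (h : P.Generated φ r i) : P.Created φ (r.headVar i) :=
  .rule r i {j | P.Created φ (r.argVar i j)} h.1 h.2.2 h.2.1 fun _ hk => hk

/-- This puts all of vars(M) among the magic variables. In the conjunctive case every atom is
created, in particular those preceding `j`. -/
theorem Generated.magic_arg (h : P.Generated φ r i) (j : Fin r.arity) :
    P.Magic φ (r.argVar i j) := by
  obtain ⟨hr, hm, hs⟩ := h
  by_cases hj : j ∈ (φ r).atoms
  · cases hφ : φ r with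
    | tru => simp [hφ, Cond.atoms] at hj
    | fls => simp [hφ, Cond.atoms] at hj
    | conj l =>
      rw [hφ] at hj hs
      obtain ⟨l₁, l₂, rfl⟩ := List.append_of_mem (show j ∈ l from hj)
      exact .conj r i l₁ l₂ j hr hφ hm fun k hk => hs k (List.mem_append_left _ hk)
    | disj l =>
      rw [hφ] at hj
      exact .disj r i l j hr hφ hj hm
  · exact .rest r i {j | P.Created φ (r.argVar i j)} j hr hj hs hm fun _ hk => hk

theorem magic_of_mem_magicVars {x : GVar Idx} (hx : x ∈ P.magicVars φ) : P.Magic φ x := by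
  rcases hx with h | h | ⟨r, i, hg, h⟩
  · exact .query x (Or.inl h)
  · exact .query x (Or.inr (Or.inl h))
  · rcases h with rfl | ⟨j, rfl⟩
    · exact hg.2.1
    · exact hg.magic_arg j

/-- For a conjunction, an atom becomes magic only after its predecessors are created. The induction
therefore moves along the list: the created prefix makes the next atom magic, and `hp` then makes it
created. -/
theorem generated_of_sat {p : Fin r.arity → Prop} (hr : r ∈ P.rules)
    (hm : P.Magic φ (r.headVar i)) (hs : (φ r).Sat p)
    (hp : ∀ j ∈ (φ r).atoms, P.Magic φ (r.argVar i j) → p j → P.Created φ (r.argVar i j)) :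
    P.Generated φ r i := by
  refine ⟨hr, hm, ?_⟩
  cases hφ : φ r with
  | tru => trivial
  | fls =>
    rw [hφ] at hs
    exact hs
  | conj l =>
    rw [hφ] at hs hp
    have key : ∀ l₁ l₂ : List (Fin r.arity), l = l₁ ++ l₂ →
        (∀ j ∈ l₁, P.Created φ (r.argVar i j)) → ∀ j ∈ l, P.Created φ (r.argVar i j) := by
      intro l₁ l₂
      induction l₂ generalizing l₁ with
      | nil => simp +contextual
      | cons a l₂ ih =>
        intro hl h₁
        refine ih (l₁ ++ [a]) (by simp [hl]) fun j hj => ?_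
        rcases List.mem_append.1 hj with hj | hj
        · exact h₁ j hj
        · obtain rfl := List.mem_singleton.1 hj
          have hjl : j ∈ l := by simp [hl]
          exact hp j hjl (.conj r i l₁ l₂ j hr (hl ▸ hφ) hm h₁) (hs j hjl)
    exact key [] l rfl (by simp)
  | disj l =>
    rw [hφ] at hs hp
    obtain ⟨j, hj, hpj⟩ := hs
    exact ⟨j, hj, hp j hj (.disj r i l j hr hφ hj hm) hpj⟩

/-- An instance that is not generated does not justify its magic head above its bound, provided
that the magic variables that are not created do not exceed their bounds. -/
theorem eval_mixVal_le_ujb (hφ : ∀ r ∈ P.rules, P.Necessary ujb r (φ r)) (hθ : P.InDom θ)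
    (hη : P.InDom η) (hr : r ∈ P.rules) (hm : P.Magic φ (r.headVar i))
    (hg : ¬ P.Generated φ r i)
    (hle : ∀ x, x.1 ∈ P.founded → P.Magic φ x → ¬ P.Created φ x → η x ≤ ujb x) :
    r.eval i (P.mixVal r i θ η) ≤ ujb (r.headVar i) := by
  by_contra hlt
  have hs := (hφ r hr).2 i (onVars _ θ) (onVars _ η) (fun x => hθ x.1) (fun x => hη x.1)
    (not_le.1 hlt)
  refine hg (generated_of_sat hr hm hs fun j hj hmj hlt => ?_)
  by_contra hc
  exact (hle _ ((hφ r hr).1 j hj) hmj hc).not_gt hlt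

theorem UnconditionallyJustified.le (hujb : P.UnconditionallyJustified ujb) (hθ : P.InDom θ)
    (hη : P.InDom η) (h : ∀ r ∈ P.rules, ∀ i, P.SatInst θ η r i) {x : GVar Idx}
    (hx : x.1 ∈ P.founded) : ujb x ≤ η x :=
  hujb (onVars _ θ) (onVars _ η) (fun x => hθ x.1) (fun x => hη x.1)
    (ground_satisfiesReduct_iff.2 h) ⟨x, P.mem_ground_vars x⟩ hx

-- From the exhaustive grounding to the magic grounding

/-- In a stable solution of the exhaustive grounding, magic variables that are not created do not
exceed their bounds. -/
theorem le_ujb_of_ground_stable (hujb : P.UnconditionallyJustified ujb)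
    (hφ : ∀ r ∈ P.rules, P.Necessary ujb r (φ r)) (hθ : P.InDom θ)
    (hst : P.ground.Stable (onVars _ θ)) {x : GVar Idx} (hx : x.1 ∈ P.founded)
    (hm : P.Magic φ x) (hc : ¬ P.Created φ x) : θ x ≤ ujb x := by
  classical
  obtain ⟨-, hr, hmin⟩ := (ground_stable_iff hθ).1 hst
  have hself : ∀ r ∈ P.rules, ∀ i, P.SatInst θ θ r i := fun r hr' i => satInst_self.2 (hr r hr' i)
  let η : (x : GVar Idx) → Val x.1 := fun x =>
    if x.1 ∈ P.founded ∧ P.Magic φ x ∧ ¬ P.Created φ x then ujb x else θ x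
  have hη : P.InDom η := hθ.of_standard fun x hx => if_neg fun h => hx h.1
  have hle : ∀ x, x.1 ∈ P.founded → η x ≤ θ x := by
    intro x hx
    by_cases h : x.1 ∈ P.founded ∧ P.Magic φ x ∧ ¬ P.Created φ x
    · simpa only [η, if_pos h] using hujb.le hθ hθ hself hx
    · simp only [η, if_neg h, le_refl]
  have hsat : ∀ r ∈ P.rules, ∀ i, P.SatInst θ η r i := by
    intro r hr' i
    -- A rule with a lowered head is not generated, since its head is not created, so it demands at
    -- most `ujb`. Any other rule keeps its head value while its founded body variables only
    -- decrease.
    by_cases h : (r.headVar i).1 ∈ P.founded ∧ P.Magic φ (r.headVar i) ∧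
        ¬ P.Created φ (r.headVar i)
    · rw [SatInst]
      simp only [η, if_pos h]
      exact eval_mixVal_le_ujb hφ hθ hη hr' h.2.1 (fun hg => h.2.2 hg.created)
        fun x hx hm hc => (if_pos ⟨hx, hm, hc⟩ : η x = ujb x).le
    · exact (hself r hr' i).of_le hθ hθ hη (if_neg h) hle
  have := hmin η hη hsat x hx
  rwa [show η x = ujb x from if_pos ⟨hx, hm, hc⟩] at this

theorem magicGround_stable_of_ground_stable (hujb : P.UnconditionallyJustified ujb)
    (hφ : ∀ r ∈ P.rules, P.Necessary ujb r (φ r)) (hθ : P.InDom θ)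
    (hst : P.ground.Stable (onVars _ θ)) : (P.magicGround φ ujb).Stable (onVars _ θ) := by
  classical
  have hstd := fun {x} => le_ujb_of_ground_stable (x := x) hujb hφ hθ hst
  obtain ⟨hc, hr, hmin⟩ := (ground_stable_iff hθ).1 hst
  have hself : ∀ r ∈ P.rules, ∀ i, P.SatInst θ θ r i := fun r hr' i => satInst_self.2 (hr r hr' i)
  refine (magicGround_stable_iff hθ).2 ⟨hc, fun r i hg => hr r hg.1 i,
    fun x _ hx => hujb.le hθ hθ hself hx, fun η hη hs hb x hx hf => ?_⟩
  -- The competitor in G: the minimum with `θ` on vars(M), and `θ` itself elsewhere.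
  let η' : (x : GVar Idx) → Val x.1 := fun x =>
    if x ∈ P.magicVars φ then min (η x) (θ x) else θ x
  have hη' : P.InDom η' := (hη.min hθ).ite hθ _
  have hle : ∀ x, η' x ≤ θ x := by
    intro x
    by_cases h : x ∈ P.magicVars φ <;> simp [η', h]
  have hsat : ∀ r ∈ P.rules, ∀ i, P.SatInst θ η' r i := by
    intro r hr' i
    by_cases hg : P.Generated φ r i
    · have hmem := hg.instVars_subset
      have h := (hs r i hg).min hθ hη hθ (hself r hr' i)
      have e : ∀ x ∈ r.instVars i, η' x = min (η x) (θ x) := fun x hx => if_pos (hmem hx)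
      rw [SatInst] at h ⊢
      rw [e _ (r.head_mem i)]
      convert h using 1
      refine congrArg r.fn (funext fun j => ?_)
      simp only [NProgram.mixVal, e _ (r.arg_mem i j)]
    -- An instance that is not generated demands at most `ujb` of a head in vars(M), and both `η`
    -- and `θ` reach that bound. A head outside vars(M) keeps its value under `θ`.
    · by_cases hh : r.headVar i ∈ P.magicVars φ
      · have h := eval_mixVal_le_ujb hφ hθ hη' hr' (magic_of_mem_magicVars hh) hg
          fun x hx hm hc => (hle x).trans (hstd hx hm hc)
        refine h.trans ?_
        have hf := P.head_founded r hr'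
        simp only [η', if_pos hh]
        exact le_min (hb _ hh hf) (hujb.le hθ hθ hself hf)
      · exact (hself r hr' i).of_le hθ hθ hη' (if_neg hh) fun x _ => hle x
  have h := hmin η' hη' hsat x hf
  simp only [η', if_pos hx] at h
  exact h.trans (min_le_left _ _)

/-! ### Least values level by level -/

/-- Body functions of rules whose head is not magic are increasing in the arguments of the same
level as the head. -/
theorem increasingArg_of_not_magic [Finite Arr] (hP : P.Valid) (hr : r ∈ P.rules)
    (hm : ¬ P.Magic φ (r.headVar i)) {j : Fin r.arity} (hj : r.arr j ∈ P.founded)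
    (hrank : P.rank (r.arr j) = P.rank r.headArr) : P.IncreasingArg r j := by
  have hsc := (edge_of_mem_rules hr hj).sameComponent hrank.ge
  by_contra hinc
  -- A decreasing edge that is not increasing makes the component unstratified, so the head would be
  -- in the query.
  have hdec := (hP r hr j hj hsc).resolve_left hinc
  exact hm (.query _ (Or.inr (Or.inr ⟨P.head_founded r hr, r, hr, j, hj, hsc, hdec, hinc, .refl,
    .refl⟩)))

/-- `IncreasingArg` concerns a single argument, so the arguments are exchanged one by one. -/
theorem eval_le_eval (hσ : P.InDom σ) (hτ : P.InDom τ)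
    (h : ∀ j, σ (r.argVar i j) = τ (r.argVar i j) ∨
      (P.IncreasingArg r j ∧ σ (r.argVar i j) ≤ τ (r.argVar i j))) :
    r.eval i σ ≤ r.eval i τ := by
  classical
  let hyb : Finset (Fin r.arity) → (j : Fin r.arity) → Val (r.arr j) := fun s j =>
    if j ∈ s then σ (r.argVar i j) else τ (r.argVar i j)
  have hyb_dom : ∀ s k, hyb s k ∈ P.gdom (r.argVar i k) := by
    intro s k
    by_cases hk : k ∈ s
    · simpa only [hyb, if_pos hk] using hσ _
    · simpa only [hyb, if_neg hk] using hτ _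
  have key : ∀ s, r.fn (hyb s) ≤ r.eval i τ := by
    intro s
    induction s using Finset.induction_on with
    | empty => simp [hyb, NRule.eval]
    | insert a s ha ih =>
      have hne : ∀ k, k ≠ a → hyb (insert a s) k = hyb s k := fun k hk => by simp [hyb, hk]
      have h1 : hyb (insert a s) a = σ (r.argVar i a) := by simp [hyb]
      have h2 : hyb s a = τ (r.argVar i a) := by simp [hyb, ha]
      refine le_trans ?_ ih
      rcases h a with e | ⟨hinc, hle⟩
      · refine (congrArg r.fn (funext fun k => ?_)).le
        by_cases hk : k = a
        · subst hk
          rw [h1, h2, e]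
        · exact hne k hk
      · exact hinc i _ _ (hyb_dom _) (hyb_dom _) hne (by rwa [h1, h2])
  simpa [hyb, NRule.eval] using key Finset.univ

variable (P φ) in
/-- The founded variables of level `n` whose magic variables are not derived. -/
def unmagicLevel (n : ℕ) : Set (GVar Idx) :=
  {x | x.1 ∈ P.founded ∧ ¬ P.Magic φ x ∧ P.rank x.1 = n}

open Classical in
variable (P φ) in
/-- The valuation `θ` with the values at the unmagic variables of level `n` taken from `g`. -/
noncomputable def override (n : ℕ) (θ g : (x : GVar Idx) → Val x.1) : (x : GVar Idx) → Val x.1 :=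
  fun x => if x ∈ P.unmagicLevel φ n then g x else θ x

variable (P φ) in
/-- `g` satisfies all rules with an unmagic head of level `n` when the variables other than these
heads have the values given by `θ`. -/
def LevelClosed (n : ℕ) (θ g : (x : GVar Idx) → Val x.1) : Prop :=
  ∀ r ∈ P.rules, ∀ i, r.headVar i ∈ P.unmagicLevel φ n →
    r.eval i (P.override φ n θ g) ≤ g (r.headVar i)

variable (P φ) in
/-- At the unmagic variables of level `n`, `θ` has the least values that satisfy the rules for
these variables. -/
def LevelLeast (n : ℕ) (θ : (x : GVar Idx) → Val x.1) : Prop :=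
  P.LevelClosed φ n θ θ ∧
    ∀ g, P.LevelClosed φ n θ g → ∀ x ∈ P.unmagicLevel φ n, θ x ≤ g x

theorem override_of_mem {n : ℕ} {x : GVar Idx} (hx : x ∈ P.unmagicLevel φ n) :
    P.override φ n θ η x = η x := if_pos hx

theorem override_of_notMem {n : ℕ} {x : GVar Idx} (hx : x ∉ P.unmagicLevel φ n) :
    P.override φ n θ η x = θ x := if_neg hx

theorem override_self {n : ℕ} : P.override φ n θ θ = θ := by
  funext x
  simp [override]

theorem InDom.override (hθ : P.InDom θ) {n : ℕ} : P.InDom (P.override φ n θ η) :=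
  hθ.of_standard fun _ hx => override_of_notMem fun h => hx h.1

theorem increasingArg_of_mem_unmagicLevel [Finite Arr] (hP : P.Valid) (hr : r ∈ P.rules) {n : ℕ}
    (hh : r.headVar i ∈ P.unmagicLevel φ n) {j : Fin r.arity}
    (hj : r.argVar i j ∈ P.unmagicLevel φ n) : P.IncreasingArg r j :=
  increasingArg_of_not_magic hP hr hh.2.1 hj.1 (hj.2.2.trans hh.2.2.symm)

/-- The least values of level `n` exist. -/
theorem exists_levelLeast [Finite Arr] (hP : P.Valid) (hθ : P.InDom θ) (n : ℕ) :
    ∃ g, P.LevelLeast φ n (P.override φ n θ g) := by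
  -- The Knaster–Tarski construction: the pointwise infimum of all closed valuations is itself
  -- closed, because the rules are monotone in the variables of the level.
  let g : (x : GVar Idx) → Val x.1 := fun x => sInf {b | ∃ h, P.LevelClosed φ n θ h ∧ b = h x}
  have hg : ∀ h, P.LevelClosed φ n θ h → ∀ x, g x ≤ h x := fun h hh x => sInf_le ⟨h, hh, rfl⟩
  have hov : ∀ h, P.override φ n (P.override φ n θ g) h = P.override φ n θ h := by
    intro h
    funext x
    by_cases hx : x ∈ P.unmagicLevel φ n <;> simp [NProgram.override, hx]
  refine ⟨g, fun r hr i hh => ?_, fun h hh x hx => ?_⟩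
  · rw [override_self, override_of_mem hh]
    refine le_sInf ?_
    rintro _ ⟨h, hcl, rfl⟩
    refine le_trans (eval_le_eval hθ.override (hθ.override (η := h)) fun j => ?_) (hcl r hr i hh)
    by_cases hj : r.argVar i j ∈ P.unmagicLevel φ n
    · right
      rw [override_of_mem hj, override_of_mem hj]
      exact ⟨increasingArg_of_mem_unmagicLevel hP hr hh hj, hg h hcl _⟩
    · left
      rw [override_of_notMem hj, override_of_notMem hj]
  · rw [override_of_mem hx]
    refine hg h (fun r hr i hi => ?_) x
    have := hh r hr i hi
    rwa [hov] at this

/-- Changing the unmagic variables of higher levels does not affect the rules of level `n`. -/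
theorem LevelLeast.congr [Finite Arr] {n : ℕ} (h : P.LevelLeast φ n θ)
    (heq : ∀ x, x.1 ∉ P.founded ∨ P.rank x.1 ≤ n → η x = θ x) : P.LevelLeast φ n η := by
  have key : ∀ g g', (∀ x ∈ P.unmagicLevel φ n, g x = g' x) →
      P.LevelClosed φ n θ g → P.LevelClosed φ n η g' := by
    intro g g' hgg hg r hr i hh
    rw [← hgg _ hh]
    convert hg r hr i hh using 1
    refine congrArg r.fn (funext fun j => ?_)
    by_cases hj : r.argVar i j ∈ P.unmagicLevel φ n
    · rw [override_of_mem hj, override_of_mem hj, hgg _ hj]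
    · rw [override_of_notMem hj, override_of_notMem hj]
      -- Founded body arrays have rank at most that of the head, hence at most `n`.
      refine heq _ (or_iff_not_imp_left.2 fun hf => ?_)
      exact (edge_of_mem_rules hr (not_not.1 hf)).rank_le.trans hh.2.2.le
  have key' : ∀ g, P.LevelClosed φ n η g → P.LevelClosed φ n θ g := by
    intro g hg r hr i hh
    convert hg r hr i hh using 1
    refine congrArg r.fn (funext fun j => ?_)
    by_cases hj : r.argVar i j ∈ P.unmagicLevel φ n
    · rw [override_of_mem hj, override_of_mem hj]
    · rw [override_of_notMem hj, override_of_notMem hj]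
      refine (heq _ (or_iff_not_imp_left.2 fun hf => ?_)).symm
      exact (edge_of_mem_rules hr (not_not.1 hf)).rank_le.trans hh.2.2.le
  refine ⟨key θ η (fun x hx => (heq x (Or.inr hx.2.2.le)).symm) h.1, fun g hg x hx => ?_⟩
  rw [heq x (Or.inr hx.2.2.le)]
  exact h.2 g (key' g hg) x hx

/-- Levels are settled from the bottom up. Settling level `n` changes only variables of rank `n`, so
lower levels stay least by `LevelLeast.congr`. -/
theorem exists_levelLeast_lt [Finite Arr] (hP : P.Valid) (hθ : P.InDom θ) (n : ℕ) :
    ∃ η, P.InDom η ∧ (∀ x, x.1 ∉ P.founded ∨ P.Magic φ x → η x = θ x) ∧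
      ∀ k < n, P.LevelLeast φ k η := by
  induction n with
  | zero => exact ⟨θ, hθ, fun _ _ => rfl, fun k hk => absurd hk (Nat.not_lt_zero k)⟩
  | succ n ih =>
    obtain ⟨η, hη, hext, hl⟩ := ih
    obtain ⟨g, hg⟩ := exists_levelLeast (φ := φ) hP hη n
    refine ⟨P.override φ n η g, hη.override, fun x hx => ?_, fun k hk => ?_⟩
    · rw [override_of_notMem fun h => hx.elim (fun h' => h' h.1) h.2.1, hext x hx]
    · rcases (Nat.lt_succ_iff.1 hk).lt_or_eq with hk | rfl
      · refine (hl k hk).congr fun x hx => override_of_notMem fun h => ?_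
        rcases hx with hx | hx
        · exact hx h.1
        · exact absurd h.2.2 (by omega)
      · exact hg

/-- A valuation can be changed at the founded variables that are not magic so that all levels have
their least values. -/
theorem exists_levelLeast_all [Finite Arr] (hP : P.Valid) (hθ : P.InDom θ) :
    ∃ η, P.InDom η ∧ (∀ x, x.1 ∉ P.founded ∨ P.Magic φ x → η x = θ x) ∧
      ∀ k, P.LevelLeast φ k η := by
  -- A rank may equal `Nat.card Arr`, hence the `+ 1`; all levels beyond are empty.
  obtain ⟨η, hη, hext, hl⟩ := exists_levelLeast_lt (φ := φ) hP hθ (Nat.card Arr + 1)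
  refine ⟨η, hη, hext, fun k => ?_⟩
  by_cases hk : k < Nat.card Arr + 1
  · exact hl k hk
  · have hempty : ∀ x, x ∉ P.unmagicLevel φ k := fun x hx => by
      have := rank_le_card (P := P) x.1
      have := hx.2.2
      omega
    exact ⟨fun r _ i hh => absurd hh (hempty _), fun _ _ x hx => absurd hx (hempty x)⟩

/-! ### Stable solutions of the magic grounding -/

/-- In a stable solution of the magic grounding, variables that are not created do not exceed their
bounds. -/
theorem le_ujb_of_magicGround_stable (hθ : P.InDom θ)
    (hst : (P.magicGround φ ujb).Stable (onVars _ θ)) {x : GVar Idx} (hx : x.1 ∈ P.founded)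
    (hmem : x ∈ P.magicVars φ) (hc : ¬ P.Created φ x) : θ x ≤ ujb x := by
  classical
  obtain ⟨-, hr, hb, hmin⟩ := (magicGround_stable_iff hθ).1 hst
  let η : (x : GVar Idx) → Val x.1 := fun x =>
    if x.1 ∈ P.founded ∧ x ∈ P.magicVars φ ∧ ¬ P.Created φ x then ujb x else θ x
  have hη : P.InDom η := hθ.of_standard fun x hx => if_neg fun h => hx h.1
  have hle : ∀ x, x.1 ∈ P.founded → η x ≤ θ x := by
    intro x hx
    by_cases h : x.1 ∈ P.founded ∧ x ∈ P.magicVars φ ∧ ¬ P.Created φ x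
    · simpa only [η, if_pos h] using hb x h.2.1 hx
    · simp only [η, if_neg h, le_refl]
  have h := hmin η hη
    -- Heads of generated rules are created, so they keep their values under `θ`.
    (fun r i hg => (satInst_self.2 (hr r i hg)).of_le hθ hθ hη
      (if_neg fun h => h.2.2 hg.created) hle)
    (fun x hx hf => by
      by_cases h : x.1 ∈ P.founded ∧ x ∈ P.magicVars φ ∧ ¬ P.Created φ x
      · simp only [η, if_pos h, le_refl]
      · simpa only [η, if_neg h] using hb x hx hf)
    x hmem hx
  rwa [show η x = ujb x from if_pos ⟨hx, hmem, hc⟩] at h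

/-- A founded body variable of the same level as an unmagic head stays a variable in the reduct. -/
theorem kept_of_mem_unmagicLevel [Finite Arr] (hP : P.Valid) (hr : r ∈ P.rules) {n : ℕ}
    (hh : r.headVar i ∈ P.unmagicLevel φ n) {j : Fin r.arity}
    (hj : r.argVar i j ∈ P.unmagicLevel φ n) : P.ground.Kept (r.inst i) (r.argVar i j) := by
  refine or_iff_not_imp_left.2 fun hne => ⟨hj.1, r.arg_mem i j, ?_⟩
  intro σ τ hσ hτ hs hlt heq
  have hhead : τ ⟨r.headVar i, r.head_mem i⟩ = σ ⟨r.headVar i, r.head_mem i⟩ :=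
    heq ⟨r.headVar i, r.head_mem i⟩ fun e => hne e.symm
  have hs' : r.bodyValue i σ ≤ σ ⟨r.headVar i, r.head_mem i⟩ := hs
  change r.bodyValue i τ ≤ τ ⟨r.headVar i, r.head_mem i⟩
  rw [hhead]
  refine le_trans ?_ hs'
  obtain ⟨ρ, hρ⟩ : ∃ ρ : (x : GVar Idx) → Val x.1, P.InDom ρ :=
    ⟨fun x => (P.dom_nonempty x).some, fun x _ => (P.dom_nonempty x).some_mem⟩
  have hdom : ∀ σ' : (x : GVar Idx) → Val x.1,
      (onVars (r.instVars i) σ').InDom P.gdom → (∀ x ∉ r.instVars i, σ' x = ρ x) →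
      P.InDom σ' := by
    intro σ' h1 h2 x
    by_cases hx : x ∈ r.instVars i
    · exact h1 ⟨x, hx⟩
    · rw [h2 x hx]
      exact hρ x
  obtain ⟨σ, rfl, hσo⟩ := exists_extension (r.instVars i) σ ρ
  obtain ⟨τ, rfl, hτo⟩ := exists_extension (r.instVars i) τ ρ
  refine eval_le_eval (r := r) (i := i) (hdom τ hτ hτo) (hdom σ hσ hσo) fun k => ?_
  -- The same ground variable may fill several argument positions; the body function is increasing
  -- in each of them.
  by_cases hk : r.argVar i k = r.argVar i j
  · right
    refine ⟨increasingArg_of_mem_unmagicLevel hP hr hh (hk ▸ hj), ?_⟩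
    rw [hk]
    exact le_of_lt hlt
  · left
    exact heq ⟨r.argVar i k, r.arg_mem i k⟩ hk

/-- A solution of the reduct that does not exceed `θ` and agrees with it at the magic variables
agrees with it at all founded variables, if `θ` has the least values at all levels. -/
theorem le_of_levelLeast [Finite Arr] (hP : P.Valid)
    (hl : ∀ k, P.LevelLeast φ k θ) (hs : ∀ r ∈ P.rules, ∀ i, P.SatInst θ η r i)
    (hle : ∀ x, x.1 ∈ P.founded → η x ≤ θ x)
    (hmagic : ∀ x, x.1 ∈ P.founded → P.Magic φ x → θ x ≤ η x) (x : GVar Idx)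
    (hx : x.1 ∈ P.founded) : θ x ≤ η x := by
  induction hn : P.rank x.1 using Nat.strong_induction_on generalizing x with
  | _ n ih =>
    by_cases hm : P.Magic φ x
    · exact hmagic x hx hm
    refine (hl n).2 η (fun r hr i hh => ?_) x ⟨hx, hm, hn⟩
    refine le_of_eq_of_le (congrArg r.fn (funext fun j => ?_)) (hs r hr i)
    by_cases hj : r.argVar i j ∈ P.unmagicLevel φ n
    · rw [override_of_mem hj]
      exact (if_pos (kept_of_mem_unmagicLevel hP hr hh hj)).symm
    · rw [override_of_notMem hj, NProgram.mixVal]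
      by_cases hk : P.ground.Kept (r.inst i) (r.argVar i j)
      · rw [if_pos hk]
        have hf : (r.argVar i j).1 ∈ P.founded := by
          rcases hk with h | h
          · rw [h]
            exact hh.1
          · exact h.1
        refine le_antisymm ?_ (hle _ hf)
        by_cases hm : P.Magic φ (r.argVar i j)
        · exact hmagic _ hf hm
        · have h1 : P.rank (r.arr j) ≤ n := (edge_of_mem_rules hr hf).rank_le.trans hh.2.2.le
          have h2 : P.rank (r.arr j) ≠ n := fun e => hj ⟨hf, hm, e⟩
          exact ih _ (lt_of_le_of_ne h1 h2) (r.argVar i j) hf rfl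
      · rw [if_neg hk]

/-- Magic variables keep their values while the unmagic levels are solved, so stability in M can be
used unchanged on vars(M). -/
theorem exists_ground_stable [Finite Arr] (hP : P.Valid) (hujb : P.UnconditionallyJustified ujb)
    (hφ : ∀ r ∈ P.rules, P.Necessary ujb r (φ r)) (hθ : P.InDom θ)
    (hst : (P.magicGround φ ujb).Stable (onVars _ θ)) :
    ∃ θ', P.InDom θ' ∧ P.ground.Stable (onVars _ θ') ∧ ∀ x ∈ P.magicVars φ, θ' x = θ x := by
  classical
  have hle_ujb := fun {x} => le_ujb_of_magicGround_stable (x := x) hθ hst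
  obtain ⟨hc, hr, hb, hmin⟩ := (magicGround_stable_iff hθ).1 hst
  -- No generated rule has its head outside vars(M), so a magic founded variable there is justified
  -- only up to `ujb`.
  let θ₀ : (x : GVar Idx) → Val x.1 := fun x =>
    if x.1 ∈ P.founded ∧ x ∉ P.magicVars φ then ujb x else θ x
  obtain ⟨θ', hθ', hext, hl⟩ := exists_levelLeast_all (P := P) (φ := φ) (θ := θ₀) hP
    (hθ.of_standard fun x hx => if_neg fun h => hx h.1)
  have hmem : ∀ x ∈ P.magicVars φ, θ' x = θ x := fun x hx => by
    rw [hext x (Or.inr (magic_of_mem_magicVars hx))]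
    exact if_neg fun h => h.2 hx
  have hout : ∀ x, x.1 ∈ P.founded → P.Magic φ x → x ∉ P.magicVars φ → θ' x = ujb x :=
    fun x hf hm hx => by
      rw [hext x (Or.inr hm)]
      exact if_pos ⟨hf, hx⟩
  have hge : ∀ x, x.1 ∈ P.founded → P.Magic φ x → ujb x ≤ θ' x := by
    intro x hf hm
    by_cases hx : x ∈ P.magicVars φ
    · rw [hmem x hx]
      exact hb x hx hf
    · exact (hout x hf hm hx).ge
  have hle : ∀ x, x.1 ∈ P.founded → P.Magic φ x → ¬ P.Created φ x → θ' x ≤ ujb x := by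
    intro x hf hm hcr
    by_cases hx : x ∈ P.magicVars φ
    · rw [hmem x hx]
      exact hle_ujb hf hx hcr
    · exact (hout x hf hm hx).le
  have hrules : ∀ r ∈ P.rules, ∀ i, r.eval i θ' ≤ θ' (r.headVar i) := by
    intro r hr' i
    have hf := P.head_founded r hr'
    by_cases hm : P.Magic φ (r.headVar i)
    · by_cases hg : P.Generated φ r i
      · rw [hmem _ (hg.instVars_subset (r.head_mem i))]
        convert hr r i hg using 1
        exact congrArg r.fn (funext fun j => hmem _ (hg.instVars_subset (r.arg_mem i j)))
      · have h := eval_mixVal_le_ujb hφ hθ' hθ' hr' hm hg hle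
        rw [mixVal_self] at h
        exact h.trans (hge _ hf hm)
    · have h := (hl _).1 r hr' i ⟨hf, hm, rfl⟩
      rwa [override_self] at h
  refine ⟨θ', hθ', (ground_stable_iff hθ').2 ⟨fun c hc' i => ?_, hrules, ?_⟩, hmem⟩
  · convert hc c hc' i using 2 with j
    exact hmem _ (Or.inl ⟨c, hc', i, j, rfl⟩)
  · intro η hη hs x hx
    -- `le_of_levelLeast` needs a competitor below `θ'`, hence the minimum. It solves the reduct of
    -- G, so it also respects `ujb`, as the bound rules of M require.
    have hη' := hη.min hθ'
    have hs' : ∀ r ∈ P.rules, ∀ i, P.SatInst θ' (fun x => min (η x) (θ' x)) r i :=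
      fun r hr' i => (hs r hr' i).min hθ' hη hθ' (satInst_self.2 (hrules r hr' i))
    have hbound := fun {x} => hujb.le (x := x) hθ' hη' hs'
    refine (le_of_levelLeast hP hl hs' (fun x _ => min_le_right _ _) (fun x hf hm => ?_) x
      hx).trans (min_le_left _ _)
    by_cases hxm : x ∈ P.magicVars φ
    · rw [hmem x hxm]
      have h := hmin _ hη' (fun r i hg => ?_) (fun x _ hf => hbound hf) x hxm hf
      · simpa only [hmem x hxm] using h
      · have h := hs' r hg.1 i
        rw [SatInst] at h ⊢
        convert h using 1
        refine congrArg r.fn (funext fun j => ?_)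
        simp only [NProgram.mixVal, hmem _ (hg.instVars_subset (r.arg_mem i j))]
    · exact (hout x hf hm hxm).le.trans (hbound hf)

end NProgram

end MagicSets

end BFASP

-- The correspondence of stable solutions

open BFASP in
theorem theorem2 {Arr : Type u} [Finite Arr] {Idx : Arr → Type v} {Val : Arr → Type w}
    [∀ a, CompleteLinearOrder (Val a)]
    (P : NProgram.{u, v, w, t} Idx Val) (hP : P.Valid)
    (ujb : (x : GVar Idx) → Val x.1) (hujb : P.UnconditionallyJustified ujb)
    (φ : (r : NRule.{u, v, w, t} Idx Val) → Cond r.arity)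
    (hφ : ∀ r ∈ P.rules, P.Necessary ujb r (φ r)) :
    (∀ θ' : Assignment (GVal Idx Val) P.ground.vars, P.ground.Stable θ' →
      (P.magicGround φ ujb).Stable (θ'.restrict (P.magicGround_vars_subset φ ujb))) ∧
    (∀ θ : Assignment (GVal Idx Val) (P.magicGround φ ujb).vars, (P.magicGround φ ujb).Stable θ →
      ∃ θ' : Assignment (GVal Idx Val) P.ground.vars, P.ground.Stable θ' ∧
        θ'.restrict (P.magicGround_vars_subset φ ujb) = θ) := by
  constructor
  · intro θ' hst
    have hdom : P.InDom fun x => θ' ⟨x, P.mem_ground_vars x⟩ := fun x => hst.1 ⟨x, _⟩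
    exact NProgram.magicGround_stable_of_ground_stable hujb hφ hdom hst
  · intro θ hst
    -- Standard variables outside vars(M) may take any value of their nonempty domains.
    obtain ⟨σ, rfl, hout⟩ := exists_extension _ θ fun x => (P.dom_nonempty x).some
    have hdom : P.InDom σ := by
      intro x
      by_cases hx : x ∈ (P.magicGround φ ujb).vars
      · exact hst.1 ⟨x, hx⟩
      · rw [hout x hx]
        exact fun _ => (P.dom_nonempty x).some_mem
    obtain ⟨θ', -, hst', hmem⟩ := NProgram.exists_ground_stable hP hujb hφ hdom hst
    exact ⟨onVars _ θ', hst', funext fun x => hmem x.1 (x.2.elim And.left And.left)⟩
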